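/- Let $\Omega\subset\mathbb C$ be a bounded, open, simply connected domain with two distinct marked boundary points (prime ends) $a,b$, and let $m:\Omega\to[0,\infty)$ be bounded and continuous. Definition. Let $\Lambda\subsetneq\mathbb C$ be a simply connected domain with two distinct prime ends $a,b$, and let $m:\Lambda\to[0,\infty)$. Let $\psi:\Lambda\to\mathbb H$ be a conformal map with $\psi(a)=0$, $\psi(b)=\infty$ (it is unique up to a positive factor, whose choice is immaterial). A random curve $\gamma$ in $\Lambda$ from $a$ to $b$ has the law of massive SLE$_4$ with mass $m$ if $\psi(\gamma)$, parametrized by half-plane capacity, is a Loewner chain $\partial_t g_t(z)=2/(g_t(z)-W_t)$, $g_0(z)=z$, whose driving function is a weak solution of $$dW_t=2\,dB_t-2\pi\Big(\int_{\Lambda_t}m^2(w)\,P^m_t(w)\,h_t(w)\,dw\Big)dt,\qquad W_0=0,$$ with $B$ a standard Brownian motion. Here $K_t$ is the hull of $\psi(\gamma)([0,t])$, $\Lambda_t=\psi^{-1}(\mathbb H\setminus K_t)$, $f_t=g_t-W_t$; $h_t$ is the bounded harmonic function in $\Lambda_t$ with boundary values $-\tfrac12$ on the counterclockwise and $\tfrac12$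 on the clockwise boundary arc of $\Lambda_t$ from the tip $\gamma(t)$ to $b$; $G^m_t$ is the Green function of $-\Delta+m^2$ in $\Lambda_t$ with Dirichlet boundary conditions; and $$P_t(z)=\tfrac1\pi\operatorname{Im}\Big(\frac{-1}{f_t(\psi(z))}\Big),\qquad P^m_t(z)=P_t(z)-\int_{\Lambda_t}m^2(w)\,P_t(w)\,G^m_t(z,w)\,dw .$$ The integrals in this definition are understood to converge (for almost every $t$, almost surely). Statement. Let $\varphi:\Omega\to\tilde\Omega$ be a conformal map (a holomorphic bijection) with $\varphi(a)=\tilde a$ and $\varphi(b)=\tilde b$, where $\tilde a,\tilde b$ are prime ends of $\tilde\Omega$. If $\gamma$ has the law of massive SLE$_4$ in $\Omega$ from $a$ to $b$ with mass $m$, then $\varphi(\gamma)$ has the law of massive SLE$_4$ in $\tilde\Omega$ from $\tilde a$ to $\tilde b$ with mass $\tilde m:\tilde\Omega\to[0,\infty)$ given by $$\tilde m^2(\tilde w)=|(\varphi^{-1})'(\tilde w)|^2\,m^2(\varphi^{-1}(\tilde w)),\qquad \tilde w\in\tilde\Omega .$$ -/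

import Mathlib

open Set Filter Topology MeasureTheory ProbabilityTheory
open scoped NNReal

noncomputable section

namespace MassiveSLE

/-- The open upper half-plane, as a subset of `ℂ`. -/
def upperHalf : Set ℂ := {z | 0 < z.im}

/-- `f` maps the open set `U` conformally (holomorphically and bijectively) onto `V`. -/
structure IsConformalEquiv (f : ℂ → ℂ) (U V : Set ℂ) : Prop where
  differentiableOn : DifferentiableOn ℂ f U
  bijOn : BijOn f U V

/-! ### Marked boundary points -/

/-- Prime ends of a simply connected domain `Ω`. Through a conformal map `f` from the unit disc
onto `Ω`, the prime ends of `Ω` are in bijection with the unit circle; the prime end of `ζ` is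
recorded by the filter of its neighbourhoods in `Ω`, which does not depend on the choice of `f`.
For a degenerate prime end this is the precise form of the boundary point it is identified with;
a boundary point of `Ω` may carry several prime ends, and the point at infinity of an unbounded
domain may carry one. -/
def IsPrimeEnd (Ω : Set ℂ) (𝔞 : Filter ℂ) : Prop :=
  ∃ f : ℂ → ℂ, IsConformalEquiv f (Metric.ball 0 1) Ω ∧
    ∃ ζ ∈ Metric.sphere (0 : ℂ) 1, 𝔞 = map f (𝓝[Metric.ball 0 1] ζ)

/-- `ψ` is a conformal map from `Ω` onto the upper half-plane with `ψ(𝔞) = 0`, `ψ(𝔟) = ∞`. -/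
structure IsUniformizer (Ω : Set ℂ) (𝔞 𝔟 : Filter ℂ) (ψ : ℂ → ℂ) : Prop where
  conformal : IsConformalEquiv ψ Ω upperHalf
  map_start : Tendsto ψ 𝔞 (𝓝 0)
  map_target : Tendsto ψ 𝔟 (Bornology.cobounded ℂ)

/-- `γ` is a curve in `Ω` from `𝔞` to `𝔟`; only its values at positive times are used, its starting
point and its end point being the prime ends `𝔞` and `𝔟`. -/
structure IsCurveFromTo (Ω : Set ℂ) (𝔞 𝔟 : Filter ℂ) (γ : ℝ≥0 → ℂ) : Prop where
  continuousOn : ContinuousOn γ (Ioi 0)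
  mem : ∀ t, 0 < t → γ t ∈ Ω
  start : Tendsto γ (𝓝[>] 0) 𝔞
  target : Tendsto γ atTop 𝔟

/-! ### Loewner chains -/

/-- The curve `ψ(γ)` in the closed upper half-plane, run at times `σ`, with starting point `0`. -/
def imageCurve (ψ : ℂ → ℂ) (γ : ℝ≥0 → ℂ) (σ : ℝ≥0 ≃o ℝ≥0) (t : ℝ≥0) : ℂ :=
  if t = 0 then 0 else ψ (γ (σ t))

/-- The complement `ℍ ∖ K_t` of the hull `K_t` generated by `η([0,t])`: the unbounded connected
component of `ℍ ∖ η([0,t])`. -/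
def hullCompl (η : ℝ≥0 → ℂ) (t : ℝ≥0) : Set ℂ :=
  {z | z ∈ upperHalf \ η '' Iic t ∧
    ¬ Bornology.IsBounded (connectedComponentIn (upperHalf \ η '' Iic t) z)}

/-- The curve `η` in the closed upper half-plane is parametrized by half-plane capacity, and `g` is
its Loewner chain, with driving function `W`: for each `t` the map `g t` is the conformal map from
`ℍ ∖ K_t` onto `ℍ` with `g t z = z + 2 t / z + o(1/z)` at infinity, and
`∂ₜ g t z = 2 / (g t z - W t)`, `g 0 z = z`. -/
structure IsLoewnerChain (η : ℝ≥0 → ℂ) (W : ℝ≥0 → ℝ) (g : ℝ≥0 → ℂ → ℂ) : Prop where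
  curve_continuous : Continuous η
  curve_zero : η 0 = 0
  driving_continuous : Continuous W
  conformal : ∀ t, IsConformalEquiv (g t) (hullCompl η t) upperHalf
  normalized : ∀ t, Tendsto (fun z => g t z - z)
    (Bornology.cobounded ℂ ⊓ 𝓟 (hullCompl η t)) (𝓝 0)
  capacity : ∀ t : ℝ≥0, Tendsto (fun z => z * (g t z - z))
    (Bornology.cobounded ℂ ⊓ 𝓟 (hullCompl η t)) (𝓝 (2 * ((t : ℝ) : ℂ)))
  initial : ∀ z ∈ upperHalf, g 0 z = z
  loewner : ∀ t : ℝ≥0, ∀ z ∈ hullCompl η t,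
    HasDerivWithinAt (fun s : ℝ => g s.toNNReal z) (2 / (g t z - (W t : ℂ))) (Ici 0) (t : ℝ)

/-! ### Massive Green function, Poisson kernel and harmonic functions -/

/-- `u = G^m_Λ(z, ·)` is the massive Green function in `Λ` with mass `m`, pole `z` and Dirichlet
boundary conditions: `(-Δ + m²) u = δ_z` in the sense of distributions on `Λ`, and `u` tends to `0`
at the boundary of `Λ` (including the point at infinity if `Λ` is unbounded). -/
structure IsMassiveGreen (Λ : Set ℂ) (m : ℂ → ℝ) (z : ℂ) (u : ℂ → ℝ) : Prop where
  continuousOn : ContinuousOn u (Λ \ {z})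
  locallyIntegrable : LocallyIntegrableOn u Λ
  distributional : ∀ f : ℂ → ℝ, ContDiff ℝ (⊤ : ℕ∞) f → HasCompactSupport f → tsupport f ⊆ Λ →
    ∫ w in Λ, u w * (-(Laplacian.laplacian f w) + m w ^ 2 * f w) = f z
  dirichlet : ∀ ε > 0, ∃ K ⊆ Λ, IsCompact K ∧ ∀ w ∈ Λ \ K, |u w| < ε

/-- `h` is the bounded harmonic function in `Λ` with boundary values `-1/2` on the counterclockwise
and `1/2` on the clockwise boundary arc from the starting point to the target point, where
`Φ : Λ → ℍ` is a conformal map sending these two points to `0` and `∞`: the two boundary arcs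
(made of prime ends) are those that `Φ` maps to the positive and to the negative half-line. -/
structure IsArcHarmonic (Λ : Set ℂ) (Φ : ℂ → ℂ) (h : ℂ → ℝ) : Prop where
  harmonic : InnerProductSpace.HarmonicOnNhd h Λ
  bounded : ∃ C : ℝ, ∀ z ∈ Λ, |h z| ≤ C
  counterclockwise : ∀ x : ℝ, 0 < x →
    Tendsto h (comap Φ (𝓝 (x : ℂ)) ⊓ 𝓟 Λ) (𝓝 (-1 / 2))
  clockwise : ∀ x : ℝ, x < 0 →
    Tendsto h (comap Φ (𝓝 (x : ℂ)) ⊓ 𝓟 Λ) (𝓝 (1 / 2))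

/-- `P_Λ(z) = (1/π) Im (-1/Φ(z))`. -/
def poissonKernel (Φ : ℂ → ℂ) (z : ℂ) : ℝ :=
  1 / Real.pi * (-1 / Φ z).im

/-- `P^m_Λ(z) = P_Λ(z) - ∫_Λ m²(w) P_Λ(w) G^m_Λ(z, w) dw`. -/
def massivePoissonKernel (Λ : Set ℂ) (Φ : ℂ → ℂ) (m : ℂ → ℝ) (G : ℂ → ℂ → ℝ) (z : ℂ) : ℝ :=
  poissonKernel Φ z - ∫ w in Λ, m w ^ 2 * poissonKernel Φ w * G z w

/-- `d = ∫_Λ m²(w) P^m_Λ(w) h_Λ(w) dw`, where `P^m_Λ` is built from the massive Green function and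
`h_Λ` is the harmonic function with boundary values `∓1/2`; both are unique (except for
the irrelevant value of `G z` at `z`), and all the integrals are required to converge. -/
def IsDrift (Λ : Set ℂ) (Φ : ℂ → ℂ) (m : ℂ → ℝ) (d : ℝ) : Prop :=
  ∃ (G : ℂ → ℂ → ℝ) (h : ℂ → ℝ),
    (∀ z ∈ Λ, IsMassiveGreen Λ m z (G z)) ∧
    IsArcHarmonic Λ Φ h ∧
    (∀ z ∈ Λ, IntegrableOn (fun w => m w ^ 2 * poissonKernel Φ w * G z w) Λ) ∧
    IntegrableOn (fun w => m w ^ 2 * massivePoissonKernel Λ Φ m G w * h w) Λ ∧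
    d = ∫ w in Λ, m w ^ 2 * massivePoissonKernel Λ Φ m G w * h w

/-! ### Massive SLE₄ -/

/-- `B` is a standard one-dimensional Brownian motion with respect to the filtration `𝓕`. -/
structure IsFilteredBrownian {S : Type*} {mS : MeasurableSpace S} (μ : Measure S)
    (𝓕 : Filtration ℝ≥0 mS) (B : ℝ≥0 → S → ℝ) : Prop where
  brownian : IsBrownianReal B μ
  adapted : ∀ t, Measurable[𝓕 t] (B t)
  indep : ∀ s t, s ≤ t →
    Indep (MeasurableSpace.comap (fun ω => B t ω - B s ω) inferInstance) (𝓕 s) μ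

/-- The pathwise part of the definition of massive SLE₄, for the conformal map `ψ : Ω → ℍ`: when
parametrized by half-plane capacity (that is, run at the times `σ`), `ψ(γ)` is a Loewner chain whose
driving function satisfies
`W_t = 2 B_t - 2π ∫₀ᵗ (∫_{Ω_s} m²(w) P^m_s(w) h_s(w) dw) ds`.
Here `Ω_s = ψ⁻¹(ℍ ∖ K_s)` is mapped conformally to `ℍ` by `f_s ∘ ψ`, with `f_s = g_s - W_s`. -/
def SolvesDrivingEquation (Ω : Set ℂ) (m : ℂ → ℝ) (ψ : ℂ → ℂ) (γ : ℝ≥0 → ℂ)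
    (W B : ℝ≥0 → ℝ) : Prop :=
  ∃ (σ : ℝ≥0 ≃o ℝ≥0) (g : ℝ≥0 → ℂ → ℂ) (F : ℝ → ℝ),
    IsLoewnerChain (imageCurve ψ γ σ) W g ∧
    (∀ᵐ s ∂(volume.restrict (Ioi (0 : ℝ))),
      IsDrift {z | z ∈ Ω ∧ ψ z ∈ hullCompl (imageCurve ψ γ σ) s.toNNReal}
        (fun z => g s.toNNReal (ψ z) - (W s.toNNReal : ℂ)) m (F s)) ∧
    ∀ t : ℝ≥0, IntervalIntegrable F volume 0 t ∧
      W t = 2 * B t - 2 * Real.pi * ∫ s in (0 : ℝ)..t, F s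

/-- The random curve `γ`, defined on the probability space `(S, μ)`, has the law of massive SLE₄
with mass `m` in `Ω` from `𝔞` to `𝔟`: its driving function is a weak solution of the SDE of
massive SLE₄, for a conformal map `ψ` from `(Ω, 𝔞, 𝔟)` to `(ℍ, 0, ∞)`. Such a `ψ` is unique up to a
positive factor, and by Brownian scaling the choice of that factor does not matter. -/
def IsMassiveSLE4 {S : Type*} {mS : MeasurableSpace S} (μ : Measure S)
    (Ω : Set ℂ) (𝔞 𝔟 : Filter ℂ) (m : ℂ → ℝ) (γ : S → ℝ≥0 → ℂ) : Prop :=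
  (∀ t, 0 < t → AEMeasurable (fun ω => γ ω t) μ) ∧
  (∀ᵐ ω ∂μ, IsCurveFromTo Ω 𝔞 𝔟 (γ ω)) ∧
  ∃ ψ : ℂ → ℂ, IsUniformizer Ω 𝔞 𝔟 ψ ∧
    ∃ (𝓕 : Filtration ℝ≥0 mS) (B W : ℝ≥0 → S → ℝ),
      IsFilteredBrownian μ 𝓕 B ∧ (∀ t, Measurable[𝓕 t] (W t)) ∧
      ∀ᵐ ω ∂μ, SolvesDrivingEquation Ω m ψ (γ ω) (fun t => W t ω) (fun t => B t ω)

end MassiveSLE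

end

namespace MassiveSLE

/-! ### Conformal equivalences and their inverses -/

/-! If `ψ` uniformizes `Ω`, then `ψ ∘ φ⁻¹` uniformizes `Ω'`, and it sends `φ(γ)` to the very same
curve in the half-plane. Hulls, Loewner chain, time change, `W`, `B` and the filtration are
therefore unchanged, and only the drift has to be compared.

The mass is transformed so that `m² dw` is preserved. Since `-Δ` scales by `|φ'|²` as well, massive
Green functions are conformally invariant (`IsMassiveGreen.conformal`). The massless Poisson kernel
and the arc harmonic function depend only on the map to the half-plane, so they are invariant too. A
change of variables then gives equal drifts (`IsDrift.conformal`), applied on each slit domain in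
`SolvesDrivingEquation.conformal`. -/

theorem _root_.AnalyticAt.nhds_le_map_nhds_of_injOn {f : ℂ → ℂ} {U : Set ℂ} {z : ℂ}
    (hf : AnalyticAt ℂ f z) (hU : U ∈ 𝓝 z) (hinj : InjOn f U) : 𝓝 (f z) ≤ map f (𝓝 z) := by
  refine hf.eventually_constant_or_nhds_le_map_nhds.resolve_left fun h => ?_
  have h1 : ∀ᶠ w in 𝓝[≠] z, w = z := by
    filter_upwards [nhdsWithin_le_nhds h, nhdsWithin_le_nhds hU] with w hw hwU
    exact hinj hwU (mem_of_mem_nhds hU) hw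
  obtain ⟨w, hw, hwz⟩ := (h1.and self_mem_nhdsWithin).exists
  exact hwz hw

/-- Zeros of `f'` are isolated unless `f'` vanishes near `z`, which would make `f` locally constant.
-/
theorem _root_.AnalyticAt.eventually_deriv_ne_zero_of_injOn {f : ℂ → ℂ} {U : Set ℂ} {z : ℂ}
    (hf : AnalyticAt ℂ f z) (hU : U ∈ 𝓝 z) (hinj : InjOn f U) :
    ∀ᶠ w in 𝓝[≠] z, deriv f w ≠ 0 := by
  refine hf.deriv.eventually_eq_zero_or_eventually_ne_zero.resolve_left fun h => ?_
  obtain ⟨r, hr, hball⟩ := Metric.eventually_nhds_iff_ball.1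
    ((h.and hf.eventually_analyticAt).and hU)
  have hconst : ∀ w ∈ Metric.ball z r, f w = f z := fun w hw =>
    Metric.isOpen_ball.is_const_of_deriv_eq_zero (convex_ball z r).isPreconnected
      (fun x hx => (hball x hx).1.2.differentiableAt.differentiableWithinAt)
      (fun x hx => (hball x hx).1.1) hw (Metric.mem_ball_self hr)
  have h1 : ∀ᶠ w in 𝓝[≠] z, w = z := by
    filter_upwards [nhdsWithin_le_nhds (Metric.ball_mem_nhds z hr)] with w hw
    exact hinj (hball w hw).2 (mem_of_mem_nhds hU) (hconst w hw)
  obtain ⟨w, hw, hwz⟩ := (h1.and self_mem_nhdsWithin).exists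
  exact hwz hw

namespace IsConformalEquiv

variable {f g : ℂ → ℂ} {U V : Set ℂ}

theorem analyticAt (hf : IsConformalEquiv f U V) (hU : IsOpen U) {z : ℂ} (hz : z ∈ U) :
    AnalyticAt ℂ f z :=
  hf.differentiableOn.analyticAt (hU.mem_nhds hz)

theorem differentiableAt (hf : IsConformalEquiv f U V) (hU : IsOpen U) {z : ℂ} (hz : z ∈ U) :
    DifferentiableAt ℂ f z :=
  (hf.analyticAt hU hz).differentiableAt

theorem nhds_le_map_nhds (hf : IsConformalEquiv f U V) (hU : IsOpen U) {z : ℂ} (hz : z ∈ U) :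
    𝓝 (f z) ≤ map f (𝓝 z) :=
  (hf.analyticAt hU hz).nhds_le_map_nhds_of_injOn (hU.mem_nhds hz) hf.bijOn.injOn

theorem mono (hf : IsConformalEquiv f U V) {s : Set ℂ} (hs : s ⊆ U) :
    IsConformalEquiv f s (f '' s) :=
  ⟨hf.differentiableOn.mono hs, (hf.bijOn.injOn.mono hs).bijOn_image⟩

theorem isOpen_target (hf : IsConformalEquiv f U V) (hU : IsOpen U) : IsOpen V := by
  rw [← hf.bijOn.image_eq, isOpen_iff_mem_nhds]
  rintro _ ⟨z, hz, rfl⟩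
  exact hf.nhds_le_map_nhds hU hz (image_mem_map (hU.mem_nhds hz))

theorem tendsto_leftInverse (hf : IsConformalEquiv f U V) (hU : IsOpen U) (hg : LeftInvOn g f U)
    {z : ℂ} (hz : z ∈ U) : Tendsto g (𝓝 (f z)) (𝓝 z) := by
  refine (tendsto_map'_iff.2 ?_).mono_left (hf.nhds_le_map_nhds hU hz)
  refine tendsto_id.congr' ?_
  filter_upwards [hU.mem_nhds hz] with w hw
  exact (hg hw).symm

/-- Off the isolated zeros of `f'` the inverse function rule applies; at the remaining point `g` is
continuous, so the singularity is removable. Nonvanishing of `f'` everywhere is not needed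
beforehand; it follows from the chain rule afterwards. -/
theorem differentiableAt_leftInverse (hf : IsConformalEquiv f U V) (hU : IsOpen U)
    (hg : LeftInvOn g f U) {z : ℂ} (hz : z ∈ U) : DifferentiableAt ℂ g (f z) := by
  have hV := hf.isOpen_target hU
  have hgz : g (f z) = z := hg hz
  have hcont : ContinuousAt g (f z) := by
    simpa only [ContinuousAt, hgz] using hf.tendsto_leftInverse hU hg hz
  refine (Complex.analyticAt_of_differentiable_on_punctured_nhds_of_continuousAt ?_
    hcont).differentiableAt
  have hne : ∀ᶠ w in 𝓝[≠] f z, w ∈ V ∧ g w ≠ z :=  by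
    filter_upwards [nhdsWithin_le_nhds (hV.mem_nhds (hf.bijOn.mapsTo hz)), self_mem_nhdsWithin]
      with w hw hwz
    refine ⟨hw, ?_⟩
    obtain ⟨x, hx, rfl⟩ := hf.bijOn.surjOn hw
    rw [hg hx]
    rintro rfl
    exact hwz rfl
  have htend : Tendsto g (𝓝[≠] f z) (𝓝[≠] z) :=
    tendsto_nhdsWithin_iff.2
      ⟨(hf.tendsto_leftInverse hU hg hz).mono_left nhdsWithin_le_nhds, hne.mono fun w hw => hw.2⟩
  filter_upwards [hne, htend.eventually ((hf.analyticAt hU hz).eventually_deriv_ne_zero_of_injOn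
    (hU.mem_nhds hz) hf.bijOn.injOn)] with w hw hder
  obtain ⟨x, hx, rfl⟩ := hf.bijOn.surjOn hw.1
  rw [hg hx] at hder
  have hd : HasDerivAt f (deriv f (g (f x))) (g (f x)) := by
    rw [hg hx]
    exact (hf.differentiableAt hU hx).hasDerivAt
  refine (hd.of_local_left_inverse ?_ (by rwa [hg hx]) ?_).differentiableAt
  · simpa only [ContinuousAt, hg hx] using hf.tendsto_leftInverse hU hg hx
  · filter_upwards [hV.mem_nhds (hf.bijOn.mapsTo hx)] with y hy
    obtain ⟨x', hx', rfl⟩ := hf.bijOn.surjOn hy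
    rw [hg hx']

theorem leftInverse (hf : IsConformalEquiv f U V) (hU : IsOpen U) (hg : LeftInvOn g f U) :
    IsConformalEquiv g V U := by
  refine ⟨fun w hw => ?_, ?_⟩
  · obtain ⟨z, hz, rfl⟩ := hf.bijOn.surjOn hw
    exact (hf.differentiableAt_leftInverse hU hg hz).differentiableWithinAt
  · have hr : RightInvOn g f V := fun w hw => by
      obtain ⟨z, hz, rfl⟩ := hf.bijOn.surjOn hw
      rw [hg hz]
    refine (InvOn.bijOn ⟨hr, hg⟩ ?_ hf.bijOn.mapsTo)
    intro w hw
    obtain ⟨z, hz, rfl⟩ := hf.bijOn.surjOn hw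
    rwa [hg hz]

theorem deriv_leftInverse_mul_deriv (hf : IsConformalEquiv f U V) (hU : IsOpen U)
    (hg : LeftInvOn g f U) {z : ℂ} (hz : z ∈ U) : deriv g (f z) * deriv f z = 1 := by
  have h1 := ((hf.differentiableAt_leftInverse hU hg hz).hasDerivAt.comp z
    (hf.differentiableAt hU hz).hasDerivAt)
  refine h1.unique ((hasDerivAt_id z).congr_of_eventuallyEq ?_)
  filter_upwards [hU.mem_nhds hz] with w hw
  exact hg hw

/-! ### Change of variables -/

theorem hasFDerivWithinAt_real (hf : IsConformalEquiv f U V) (hU : IsOpen U) {z : ℂ}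
    (hz : z ∈ U) :
    HasFDerivWithinAt f ((deriv f z • (1 : ℂ →L[ℂ] ℂ)).restrictScalars ℝ) U z :=
  ((hf.differentiableAt hU hz).hasDerivAt.complexToReal_fderiv).hasFDerivWithinAt

theorem abs_det_smul_one (c : ℂ) :
    |((c • (1 : ℂ →L[ℂ] ℂ)).restrictScalars ℝ).det| = ‖c‖ ^ 2 := by
  have : ((c • (1 : ℂ →L[ℂ] ℂ)).restrictScalars ℝ).det = ‖c‖ ^ 2 := by
    rw [ContinuousLinearMap.det, ← LinearMap.det_toMatrix Complex.basisOneI, Matrix.det_fin_two]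
    simp [LinearMap.toMatrix_apply, ← Complex.normSq_eq_norm_sq, Complex.normSq_apply]
  rw [this, abs_of_nonneg (by positivity)]

theorem integrableOn_target_iff (hf : IsConformalEquiv f U V) (hU : IsOpen U) (F : ℂ → ℝ) :
    IntegrableOn F V ↔ IntegrableOn (fun z => ‖deriv f z‖ ^ 2 * F (f z)) U := by
  have := integrableOn_image_iff_integrableOn_abs_det_fderiv_smul volume hU.measurableSet
    (fun z hz => hf.hasFDerivWithinAt_real hU hz) hf.bijOn.injOn F
  simpa only [hf.bijOn.image_eq, abs_det_smul_one, smul_eq_mul] using this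

theorem setIntegral_target (hf : IsConformalEquiv f U V) (hU : IsOpen U) (F : ℂ → ℝ) :
    ∫ w in V, F w = ∫ z in U, ‖deriv f z‖ ^ 2 * F (f z) := by
  have := integral_image_eq_integral_abs_det_fderiv_smul volume hU.measurableSet
    (fun z hz => hf.hasFDerivWithinAt_real hU hz) hf.bijOn.injOn F
  simpa only [hf.bijOn.image_eq, abs_det_smul_one, smul_eq_mul] using this

theorem integrableOn_image_iff (hf : IsConformalEquiv f U V) (hU : IsOpen U) {K : Set ℂ}
    (hK : K ⊆ U) (hKm : MeasurableSet K) (F : ℂ → ℝ) :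
    IntegrableOn F (f '' K) ↔ IntegrableOn (fun z => ‖deriv f z‖ ^ 2 * F (f z)) K := by
  have := integrableOn_image_iff_integrableOn_abs_det_fderiv_smul volume hKm
    (fun z hz => (hf.hasFDerivWithinAt_real hU (hK hz)).mono hK) (hf.bijOn.injOn.mono hK) F
  simpa only [abs_det_smul_one, smul_eq_mul] using this

end IsConformalEquiv

/-! ### The Laplacian of a composition with a holomorphic map -/

open InnerProductSpace in
-- The second derivative along `v` is `D²u(f'v, f'v) + Du(f''v²)`. Summed over `v = 1, I`, the `f''`
-- terms cancel because `I² = -1`, and `f'`, `f'I` are orthogonal of length `|f'|`.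
theorem laplacian_comp_of_analyticAt {u : ℂ → ℝ} {f : ℂ → ℂ} {z : ℂ}
    (hu : ContDiffAt ℝ 2 u (f z)) (hf : AnalyticAt ℂ f z) :
    Laplacian.laplacian (u ∘ f) z = ‖deriv f z‖ ^ 2 * Laplacian.laplacian u (f z) := by
  have hsecond : ∀ v : ℂ, fderiv ℝ (fderiv ℝ (u ∘ f)) z v v =
      fderiv ℝ (fderiv ℝ u) (f z) (deriv f z * v) (deriv f z * v) +
        fderiv ℝ u (f z) (deriv (deriv f) z * v * v) := by
    intro v
    have hev : fderiv ℝ (u ∘ f) =ᶠ[𝓝 z] fun w =>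
        (fderiv ℝ u (f w)).comp ((deriv f w • (1 : ℂ →L[ℂ] ℂ)).restrictScalars ℝ) := by
      have hu' : ∀ᶠ y in 𝓝 (f z), ContDiffAt ℝ 2 u y := hu.eventually (by simp)
      filter_upwards [hf.eventually_analyticAt, hf.continuousAt.eventually hu'] with w hw huw
      exact ((huw.differentiableAt (by norm_num)).hasFDerivAt.comp w
        hw.differentiableAt.hasDerivAt.complexToReal_fderiv).fderiv
    rw [hev.fderiv_eq]
    have h1 : HasFDerivAt (fun w => fderiv ℝ u (f w))
        ((fderiv ℝ (fderiv ℝ u) (f z)).comp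
          ((deriv f z • (1 : ℂ →L[ℂ] ℂ)).restrictScalars ℝ)) z :=
      HasFDerivAt.comp z
        ((hu.fderiv_right (m := 1) (by norm_num)).differentiableAt (by norm_num)).hasFDerivAt
        hf.differentiableAt.hasDerivAt.complexToReal_fderiv
    have h2 : HasFDerivAt (deriv f)
        ((deriv (deriv f) z • (1 : ℂ →L[ℂ] ℂ)).restrictScalars ℝ) z :=
      hf.deriv.differentiableAt.hasDerivAt.complexToReal_fderiv
    have h3 := (ContinuousLinearMap.restrictScalarsL ℂ ℂ ℂ ℝ ℝ).hasFDerivAt.comp z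
      (h2.smul_const (1 : ℂ →L[ℂ] ℂ))
    refine (congrArg (fun L => L v v) (h1.clm_comp h3).fderiv).trans ?_
    simp [add_comm]
  rw [laplacian_eq_iteratedFDeriv_complexPlane, laplacian_eq_iteratedFDeriv_complexPlane]
  simp only [iteratedFDeriv_two_apply]
  simp only [Matrix.cons_val_zero, Matrix.cons_val_one, hsecond]
  generalize fderiv ℝ (fderiv ℝ u) (f z) = B
  generalize deriv f z = c
  generalize deriv (deriv f) z = d
  -- The cross terms cancel between `(x, y) = (re c, im c)` and `(-im c, re c)`, so symmetry of `B`
  -- plays no role.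
  have hB : ∀ x y : ℝ, B (x + y * Complex.I) (x + y * Complex.I) =
      x ^ 2 * B 1 1 + x * y * (B 1 Complex.I + B Complex.I 1)
        + y ^ 2 * B Complex.I Complex.I := by
    intro x y
    have : (x + y * Complex.I : ℂ) = x • (1 : ℂ) + y • Complex.I := by simp
    rw [this]
    simp only [map_add, map_smul, _root_.add_apply, _root_.smul_apply,
      smul_eq_mul]
    ring
  have h1 : c * 1 = (c.re : ℂ) + c.im * Complex.I := by rw [mul_one, Complex.re_add_im]
  have h2 : c * Complex.I = ((-c.im : ℝ) : ℂ) + c.re * Complex.I := by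
    apply Complex.ext <;> simp
  have h3 : d * Complex.I * Complex.I = -(d * 1 * 1) := by
    rw [mul_assoc, Complex.I_mul_I]; ring
  rw [h1, h2, hB, hB, h3, map_neg, ← Complex.normSq_eq_norm_sq, Complex.normSq_apply]
  ring

theorem _root_.AnalyticAt.contDiffAt_comp {u : ℂ → ℝ} {f : ℂ → ℂ} {z : ℂ} {n : ℕ∞}
    (hu : ContDiffAt ℝ n u (f z)) (hf : AnalyticAt ℂ f z) : ContDiffAt ℝ n (u ∘ f) z :=
  hu.comp z (hf.contDiffAt.restrict_scalars ℝ)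

theorem _root_.InnerProductSpace.HarmonicAt.comp_analyticAt {u : ℂ → ℝ} {f : ℂ → ℂ} {z : ℂ}
    (hu : InnerProductSpace.HarmonicAt u (f z)) (hf : AnalyticAt ℂ f z) :
    InnerProductSpace.HarmonicAt (u ∘ f) z := by
  refine ⟨AnalyticAt.contDiffAt_comp hu.1 hf, ?_⟩
  filter_upwards [hf.eventually_analyticAt, hf.continuousAt.eventually hu.eventually] with w hw huw
  rw [laplacian_comp_of_analyticAt huw.1 hw, huw.2.self_of_nhds]
  simp

/-! ### Conformal covariance of the massive Green function and of the drift -/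

section Covariance

variable {f g : ℂ → ℂ} {U V : Set ℂ} {m m' : ℂ → ℝ}

theorem IsMassiveGreen.conformal (hU : IsOpen U) (hf : IsConformalEquiv f U V)
    (hg : LeftInvOn g f U) (hm : ∀ z ∈ U, ‖deriv f z‖ ^ 2 * m' (f z) ^ 2 = m z ^ 2)
    {z : ℂ} (hz : z ∈ U) {u : ℂ → ℝ} (hu : IsMassiveGreen U m z u) :
    IsMassiveGreen V m' (f z) (u ∘ g) := by
  have hgc := hf.leftInverse hU hg
  have hV := hf.isOpen_target hU
  have hr : RightInvOn g f V := fun w hw => by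
    obtain ⟨x, hx, rfl⟩ := hf.bijOn.surjOn hw
    rw [hg hx]
  refine ⟨?_, ?_, ?_, ?_⟩
  · refine hu.continuousOn.comp (hgc.differentiableOn.continuousOn.mono sdiff_subset) ?_
    rintro w ⟨hw, hwz⟩
    refine ⟨hgc.bijOn.mapsTo hw, fun h => hwz ?_⟩
    rw [mem_singleton_iff] at h ⊢
    rw [← h, hr hw]
  · rw [locallyIntegrableOn_iff hV.isLocallyClosed]
    intro K hKV hK
    have hcomp : IsCompact (g '' K) :=
      hK.image_of_continuousOn (hgc.differentiableOn.continuousOn.mono hKV)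
    have hsub : g '' K ⊆ U := (hgc.bijOn.mapsTo.mono_left hKV).image_subset
    have himg : f '' (g '' K) = K := (hr.mono hKV).image_image
    -- On the compact set `g '' K` the Jacobian is continuous, so it preserves integrability of `u`.
    rw [← himg, hf.integrableOn_image_iff hU hsub hcomp.measurableSet]
    have hcont : ContinuousOn (fun x => ‖deriv f x‖ ^ 2) (g '' K) := fun x hx =>
      (((hf.analyticAt hU (hsub hx)).deriv.continuousAt.norm).pow 2).continuousWithinAt
    have hint : IntegrableOn u (g '' K) := hu.locallyIntegrable.integrableOn_compact_subset hsub hcomp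
    refine (hint.continuousOn_mul hcont hcomp).congr_fun (fun x hx => ?_) hcomp.measurableSet
    simp only [Function.comp, hg (hsub hx)]
  · intro p hp hpc hps
    have hKc : IsCompact (g '' tsupport p) :=
      IsCompact.image_of_continuousOn hpc (hgc.differentiableOn.continuousOn.mono hps)
    have hKU : g '' tsupport p ⊆ U := (hgc.bijOn.mapsTo.mono_left hps).image_subset
    -- The pulled-back test function, extended by zero; it is smooth on `ℂ` because its support is
    -- compact inside `U`.
    set q : ℂ → ℝ := U.indicator (p ∘ f) with hq
    have hqU : ∀ x ∈ U, q x = p (f x) := fun x hx => indicator_of_mem hx _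
    have hqev : ∀ x ∈ U, q =ᶠ[𝓝 x] p ∘ f := fun x hx => by
      filter_upwards [hU.mem_nhds hx] with y hy using hqU y hy
    have hsupp : Function.support q ⊆ g '' tsupport p := by
      intro x hx
      have hxU : x ∈ U := by
        by_contra h
        exact hx (indicator_of_notMem h _)
      refine ⟨f x, subset_tsupport p ?_, hg hxU⟩
      rw [Function.mem_support, ← hqU x hxU]
      exact hx
    have htsupp : tsupport q ⊆ g '' tsupport p := closure_minimal hsupp hKc.isClosed
    have hqsmooth : ContDiff ℝ (⊤ : ℕ∞) q := by
      rw [contDiff_iff_contDiffAt]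
      intro x
      by_cases hx : x ∈ tsupport q
      · have hxU := hKU (htsupp hx)
        exact (AnalyticAt.contDiffAt_comp hp.contDiffAt (hf.analyticAt hU hxU)).congr_of_eventuallyEq
          (hqev x hxU)
      · exact contDiffAt_const.congr_of_eventuallyEq (notMem_tsupport_iff_eventuallyEq.1 hx)
    have key := hu.distributional q hqsmooth (HasCompactSupport.of_support_subset_isCompact hKc hsupp)
      (htsupp.trans hKU)
    rw [hqU z hz] at key
    rw [← key, hf.setIntegral_target hU]
    -- The Jacobian `|f'|²` is exactly the factor turning `-Δp + m'²p` at `f x` into `-Δq + m²q` at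
    -- `x`.
    refine setIntegral_congr_fun hU.measurableSet fun x hx => ?_
    have hlap : Laplacian.laplacian q x = ‖deriv f x‖ ^ 2 * Laplacian.laplacian p (f x) := by
      rw [InnerProductSpace.laplacian_congr_nhds (hqev x hx) |>.self_of_nhds]
      exact laplacian_comp_of_analyticAt (contDiff_infty.1 hp 2).contDiffAt
        (hf.analyticAt hU hx)
    simp only [Function.comp, hg hx, hlap, hqU x hx, ← hm x hx]
    ring
  · intro ε hε
    obtain ⟨K, hKU, hK, hKε⟩ := hu.dirichlet ε hε
    refine ⟨f '' K, (hf.bijOn.mapsTo.mono_left hKU).image_subset,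
      hK.image_of_continuousOn (hf.differentiableOn.continuousOn.mono hKU), ?_⟩
    rintro w ⟨hw, hwK⟩
    exact hKε _ ⟨hgc.bijOn.mapsTo hw, fun h => hwK ⟨g w, h, hr hw⟩⟩

/-- The boundary arcs are seen only through `Φ`, so `g` carries each approach filter for `Φ ∘ g` to
the one for `Φ`. -/
theorem IsArcHarmonic.conformal (hg : IsConformalEquiv g V U) (hV : IsOpen V)
    {Φ : ℂ → ℂ} {h : ℂ → ℝ} (hh : IsArcHarmonic U Φ h) : IsArcHarmonic V (Φ ∘ g) (h ∘ g) := by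
  have htend : ∀ l : Filter ℂ, Tendsto g (comap (Φ ∘ g) l ⊓ 𝓟 V) (comap Φ l ⊓ 𝓟 U) := fun l =>
    (tendsto_comap_iff.2 tendsto_comap).inf (tendsto_principal_principal.2 hg.bijOn.mapsTo)
  refine ⟨fun w hw => ?_, ?_, fun x hx => (hh.counterclockwise x hx).comp (htend _),
    fun x hx => (hh.clockwise x hx).comp (htend _)⟩
  · exact (hh.harmonic _ (hg.bijOn.mapsTo hw)).comp_analyticAt (hg.analyticAt hV hw)
  · obtain ⟨C, hC⟩ := hh.bounded
    exact ⟨C, fun w hw => hC _ (hg.bijOn.mapsTo hw)⟩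

theorem massivePoissonKernel_conformal (hU : IsOpen U) (hf : IsConformalEquiv f U V)
    (hg : LeftInvOn g f U) (hm : ∀ z ∈ U, ‖deriv f z‖ ^ 2 * m' (f z) ^ 2 = m z ^ 2)
    (Φ : ℂ → ℂ) (G : ℂ → ℂ → ℝ) {z : ℂ} (hz : z ∈ U) :
    massivePoissonKernel V (Φ ∘ g) m' (fun x y => G (g x) (g y)) (f z) =
      massivePoissonKernel U Φ m G z := by
  rw [massivePoissonKernel, massivePoissonKernel, hf.setIntegral_target hU]
  congr 1
  · simp only [poissonKernel, Function.comp, hg hz]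
  · refine setIntegral_congr_fun hU.measurableSet fun x hx => ?_
    simp only [poissonKernel, Function.comp, hg hz, hg hx, ← hm x hx]
    ring

theorem IsDrift.conformal (hU : IsOpen U) (hf : IsConformalEquiv f U V)
    (hg : LeftInvOn g f U) (hm : ∀ z ∈ U, ‖deriv f z‖ ^ 2 * m' (f z) ^ 2 = m z ^ 2)
    {Φ : ℂ → ℂ} {d : ℝ} (hd : IsDrift U Φ m d) : IsDrift V (Φ ∘ g) m' d := by
  obtain ⟨G, h, hG, hh, hint, hint', hdeq⟩ := hd
  have hV := hf.isOpen_target hU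
  have hdens : ∀ x ∈ U, m x ^ 2 * massivePoissonKernel U Φ m G x * h x = ‖deriv f x‖ ^ 2 *
      (m' (f x) ^ 2 * massivePoissonKernel V (Φ ∘ g) m' (fun x y => G (g x) (g y)) (f x) *
        (h ∘ g) (f x)) := fun x hx => by
    rw [massivePoissonKernel_conformal hU hf hg hm Φ G hx, ← hm x hx, Function.comp, hg hx]
    ring
  refine ⟨fun x y => G (g x) (g y), h ∘ g, fun w hw => ?_,
    hh.conformal (hf.leftInverse hU hg) hV, fun w hw => ?_, ?_, ?_⟩
  · obtain ⟨z, hz, rfl⟩ := hf.bijOn.surjOn hw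
    simp only [hg hz]
    exact (hG z hz).conformal hU hf hg hm hz
  · obtain ⟨z, hz, rfl⟩ := hf.bijOn.surjOn hw
    rw [hf.integrableOn_target_iff hU]
    refine (hint z hz).congr_fun (fun x hx => ?_) hU.measurableSet
    simp only [poissonKernel, Function.comp, hg hz, hg hx, ← hm x hx]
    ring
  · rw [hf.integrableOn_target_iff hU]
    exact hint'.congr_fun hdens hU.measurableSet
  · rw [hdeq, hf.setIntegral_target hU]
    exact setIntegral_congr_fun hU.measurableSet hdens

end Covariance

/-! ### Conformal invariance of the driving equation -/

/-- Makes the slit domains open, as the covariance lemmas require. -/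
theorem isOpen_hullCompl {η : ℝ≥0 → ℂ} (hη : Continuous η) (t : ℝ≥0) : IsOpen (hullCompl η t) := by
  have hO : IsOpen (upperHalf \ η '' Iic t) := by
    refine (isOpen_lt continuous_const Complex.continuous_im).sdiff ?_
    have : IsCompact (Iic t) := by
      rw [← Icc_bot]
      exact isCompact_Icc
    exact (this.image hη).isClosed
  rw [isOpen_iff_mem_nhds]
  rintro z ⟨hz, hzb⟩
  filter_upwards [hO.connectedComponentIn.mem_nhds (mem_connectedComponentIn hz)] with w hw
  exact ⟨connectedComponentIn_subset _ _ hw, by rwa [← connectedComponentIn_eq hw]⟩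

theorem IsPrimeEnd.mem {Ω : Set ℂ} {𝔞 : Filter ℂ} (h : IsPrimeEnd Ω 𝔞) : Ω ∈ 𝔞 := by
  obtain ⟨f, hf, ζ, -, rfl⟩ := h
  exact mem_map.2 (mem_of_superset self_mem_nhdsWithin hf.bijOn.mapsTo)

section Transport

variable {Ω Ω' : Set ℂ} {φ χ : ℂ → ℂ} {𝔞 𝔟 : Filter ℂ} {ψ : ℂ → ℂ}

theorem IsCurveFromTo.map (hφ : IsConformalEquiv φ Ω Ω') {γ : ℝ≥0 → ℂ}
    (hγ : IsCurveFromTo Ω 𝔞 𝔟 γ) :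
    IsCurveFromTo Ω' (map φ 𝔞) (map φ 𝔟) (fun t => φ (γ t)) where
  continuousOn := hφ.differentiableOn.continuousOn.comp hγ.continuousOn fun t ht => hγ.mem t ht
  mem t ht := hφ.bijOn.mapsTo (hγ.mem t ht)
  start := tendsto_map.comp hγ.start
  target := tendsto_map.comp hγ.target

theorem IsUniformizer.comp_leftInverse (hΩ : IsOpen Ω) (hφ : IsConformalEquiv φ Ω Ω')
    (hχ : LeftInvOn χ φ Ω) (h𝔞 : Ω ∈ 𝔞) (h𝔟 : Ω ∈ 𝔟) (hψ : IsUniformizer Ω 𝔞 𝔟 ψ) :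
    IsUniformizer Ω' (map φ 𝔞) (map φ 𝔟) (ψ ∘ χ) where
  conformal := by
    have hχc := hφ.leftInverse hΩ hχ
    exact ⟨hψ.conformal.differentiableOn.comp hχc.differentiableOn hχc.bijOn.mapsTo,
      hψ.conformal.bijOn.comp hχc.bijOn⟩
  map_start := tendsto_map'_iff.2 <| hψ.map_start.congr' <| by
    filter_upwards [h𝔞] with z hz
    simp only [Function.comp, hχ hz]
  map_target := tendsto_map'_iff.2 <| hψ.map_target.congr' <| by
    filter_upwards [h𝔟] with z hz
    simp only [Function.comp, hχ hz]

/-- At positive times `χ` undoes `φ`; at time `0` both curves are `0` by convention, so no boundary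
value of `φ` enters. -/
theorem imageCurve_comp_leftInverse (hχ : LeftInvOn χ φ Ω) {γ : ℝ≥0 → ℂ}
    (hγ : ∀ t, 0 < t → γ t ∈ Ω) (σ : ℝ≥0 ≃o ℝ≥0) :
    imageCurve (ψ ∘ χ) (fun t => φ (γ t)) σ = imageCurve ψ γ σ := by
  funext t
  rcases eq_or_ne t 0 with rfl | ht
  · simp [imageCurve]
  · have hσ : 0 < σ t := by
      have h0 : σ 0 = 0 := σ.map_bot
      simpa only [h0] using σ.strictMono (pos_iff_ne_zero.2 ht)
    simp only [imageCurve, ht, if_false, Function.comp, hχ (hγ _ hσ)]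

theorem SolvesDrivingEquation.conformal (hΩ : IsOpen Ω) (hφ : IsConformalEquiv φ Ω Ω')
    (hχ : LeftInvOn χ φ Ω) {m m' : ℂ → ℝ}
    (hm : ∀ z ∈ Ω, ‖deriv φ z‖ ^ 2 * m' (φ z) ^ 2 = m z ^ 2)
    (hψ : ContinuousOn ψ Ω) {γ : ℝ≥0 → ℂ} (hγ : ∀ t, 0 < t → γ t ∈ Ω) {W B : ℝ≥0 → ℝ}
    (h : SolvesDrivingEquation Ω m ψ γ W B) :
    SolvesDrivingEquation Ω' m' (ψ ∘ χ) (fun t => φ (γ t)) W B := by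
  obtain ⟨σ, g, F, hL, hF, hW⟩ := h
  refine ⟨σ, g, F, ?_, ?_, hW⟩
  · rwa [imageCurve_comp_leftInverse hχ hγ]
  · rw [imageCurve_comp_leftInverse hχ hγ]
    filter_upwards [hF] with s hs
    set H := hullCompl (imageCurve ψ γ σ) s.toNNReal
    have hopen : IsOpen {z | z ∈ Ω ∧ ψ z ∈ H} :=
      hψ.isOpen_inter_preimage hΩ (isOpen_hullCompl hL.curve_continuous _)
    have hsub : {z | z ∈ Ω ∧ ψ z ∈ H} ⊆ Ω := fun z hz => hz.1
    -- The slit domains correspond under `φ`, so drift covariance applies to the restriction of `φ`.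
    have himg : φ '' {z | z ∈ Ω ∧ ψ z ∈ H} = {w | w ∈ Ω' ∧ (ψ ∘ χ) w ∈ H} := by
      ext w
      constructor
      · rintro ⟨z, ⟨hz, hzH⟩, rfl⟩
        refine ⟨hφ.bijOn.mapsTo hz, ?_⟩
        simpa only [Function.comp, hχ hz] using hzH
      · rintro ⟨hw, hwH⟩
        obtain ⟨z, hz, rfl⟩ := hφ.bijOn.surjOn hw
        refine ⟨z, ⟨hz, ?_⟩, rfl⟩
        simpa only [Function.comp, hχ hz] using hwH
    have hconf := hφ.mono hsub
    rw [himg] at hconf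
    exact hs.conformal hopen hconf (hχ.mono hsub) fun z hz => hm z hz.1

end Transport

/-- `φ` is arbitrary off `Ω`, so it is replaced there by `0`, which changes nothing almost surely.
-/
theorem aemeasurable_comp_of_continuousOn {S : Type*} {mS : MeasurableSpace S} {μ : Measure S}
    {Ω : Set ℂ} {φ : ℂ → ℂ} (hΩ : IsOpen Ω) (hφ : ContinuousOn φ Ω) {X : S → ℂ}
    (hX : AEMeasurable X μ) (hmem : ∀ᵐ ω ∂μ, X ω ∈ Ω) : AEMeasurable (fun ω => φ (X ω)) μ := by
  classical
  have hmeas : Measurable (Ω.piecewise φ 0) :=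
    hφ.measurable_piecewise continuousOn_const hΩ.measurableSet
  refine (hmeas.comp_aemeasurable hX).congr ?_
  filter_upwards [hmem] with ω hω
  simp only [Function.comp, piecewise_eq_of_mem _ _ _ hω]

end MassiveSLE

theorem mainTheorem7 {S : Type*} [mS : MeasurableSpace S] (μ : Measure S) [IsProbabilityMeasure μ]
    (Ω Ω' : Set ℂ) (hΩ_open : IsOpen Ω) (hΩ_bdd : Bornology.IsBounded Ω)
    (hΩ_sc : IsSimplyConnected Ω)
    (𝔞 𝔟 𝔞' 𝔟' : Filter ℂ)
    (h𝔞 : MassiveSLE.IsPrimeEnd Ω 𝔞) (h𝔟 : MassiveSLE.IsPrimeEnd Ω 𝔟) (h𝔞𝔟 : 𝔞 ≠ 𝔟)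
    (h𝔞' : MassiveSLE.IsPrimeEnd Ω' 𝔞') (h𝔟' : MassiveSLE.IsPrimeEnd Ω' 𝔟')
    (φ : ℂ → ℂ) (hφ : MassiveSLE.IsConformalEquiv φ Ω Ω')
    (hφ𝔞 : Filter.map φ 𝔞 = 𝔞') (hφ𝔟 : Filter.map φ 𝔟 = 𝔟')
    (m : ℂ → ℝ) (hm_nonneg : ∀ z ∈ Ω, 0 ≤ m z) (hm_bdd : ∃ M : ℝ, ∀ z ∈ Ω, m z ≤ M)
    (hm_cont : ContinuousOn m Ω)
    (m' : ℂ → ℝ) (hm'_nonneg : ∀ w ∈ Ω', 0 ≤ m' w)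
    (hm' : ∀ w ∈ Ω', m' w ^ 2 =
      ‖deriv (Function.invFunOn φ Ω) w‖ ^ 2 * m (Function.invFunOn φ Ω w) ^ 2)
    (γ : S → ℝ≥0 → ℂ) (hγ : MassiveSLE.IsMassiveSLE4 μ Ω 𝔞 𝔟 m γ) :
    MassiveSLE.IsMassiveSLE4 μ Ω' 𝔞' 𝔟' m' (fun ω t => φ (γ ω t)) := by
  have hχ : LeftInvOn (Function.invFunOn φ Ω) φ Ω := hφ.bijOn.injOn.leftInvOn_invFunOn
  -- The mass relation, pulled back to `Ω` through `(φ⁻¹)'(φ z) · φ'(z) = 1`.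
  have hm : ∀ z ∈ Ω, ‖deriv φ z‖ ^ 2 * m' (φ z) ^ 2 = m z ^ 2 := fun z hz => by
    rw [hm' _ (hφ.bijOn.mapsTo hz), hχ hz, ← mul_assoc, ← mul_pow, ← norm_mul, mul_comm,
      mul_comm (deriv φ z), hφ.deriv_leftInverse_mul_deriv hΩ_open hχ hz]
    simp
  obtain ⟨hmeas, hcurve, ψ, hψ, 𝓕, B, W, hB, hW, hsolve⟩ := hγ
  subst hφ𝔞 hφ𝔟
  refine ⟨fun t ht => ?_, ?_, ψ ∘ Function.invFunOn φ Ω,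
    hψ.comp_leftInverse hΩ_open hφ hχ h𝔞.mem h𝔟.mem, 𝓕, B, W, hB, hW, ?_⟩
  · refine MassiveSLE.aemeasurable_comp_of_continuousOn hΩ_open hφ.differentiableOn.continuousOn
      (hmeas t ht) ?_
    filter_upwards [hcurve] with ω hω using hω.mem t ht
  · filter_upwards [hcurve] with ω hω using hω.map hφ
  · filter_upwards [hcurve, hsolve] with ω hω hs
    exact hs.conformal hΩ_open hφ hχ hm hψ.conformal.differentiableOn.continuousOn hω.mem
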